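/- Conventions. A hyperbolic space is a geodesic metric space $X$ (not necessarily proper) for which there is $\delta\ge 0$ with $(x|z)_o\ge\min\{(x|y)_o,(y|z)_o\}-\delta$ for all $o,x,y,z\in X$, where $(x|y)_o=\frac12(d(o,x)+d(o,y)-d(x,y))$. Its Gromov boundary $\partial X$ is the set of equivalence classes of sequences $(x_i)$ in $X$ with $(x_i|x_j)_o\to\infty$ as $i,j\to\infty$, where $(x_i)\sim(y_i)$ if $(x_i|y_j)_o\to\infty$ as $i,j\to\infty$. An isometric action of a group $G$ on $X$ is elementary if its limit set in $\partial X$ (the set of limits in $\partial X$ of sequences in an orbit $Gx$) has at most two points. A group has property (NNE) if each of its isometric actions on a hyperbolic space is elementary, and is hereditary (NNE) if all of its finite-index subgroups have (NNE). Let $G$ be a group acting faithfully, by automorphisms fixing the root, on a rooted tree $(T,o)$. For $n\ge 1$ the $n$th level of $T$ is the set of vertices at distance $n$ from $o$, and $\mathrm{st}_G(n)$ is the subgroup of all $g\in G$ fixing every vertex of the $n$th level. For a vertex $v$, $\mathrm{rig}_G(v)$ is the subgroup of all $g\in G$ fixing every vertex that is not separated from $o$ by $v$, and $\mathrm{rig}_G(n)$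 is the subgroup generated by the $\mathrm{rig}_G(v)$ for $v$ in the $n$th level. The group $G$ is a branch group if for every $n\ge 1$ it acts transitively on the $n$th level and $\mathrm{rig}_G(n)$ has finite index in $G$. It has the congruence subgroup property if every finite-index subgroup of $G$ contains $\mathrm{st}_G(n)$ for some $n\ge 1$. Theorem. (1) If for some $n\ge 1$ the $n$th level of $T$ has at least two vertices, $G$ acts transitively on it, and $\mathrm{rig}_G(n)$ has finite index in $G$, then $G$ has (NNE). (2) If $G$ is a branch group, then $G$ has (NNE). (3) If $G$ is a branch group with the congruence subgroup property, then $G$ is hereditary (NNE). -/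

import Mathlib

open Filter

universe u v w

namespace NNE

/-! ### Hyperbolic spaces and their Gromov boundary -/

/-- The Gromov product `(x | y)_o`. -/
noncomputable def gromovProduct {X : Type v} [MetricSpace X] (o x y : X) : ℝ :=
  (dist o x + dist o y - dist x y) / 2

/-- Any two points are joined by an isometrically embedded segment. -/
def IsGeodesicSpace (X : Type v) [MetricSpace X] : Prop :=
  ∀ x y : X, ∃ c : ℝ → X, c 0 = x ∧ c (dist x y) = y ∧
    ∀ s ∈ Set.Icc 0 (dist x y), ∀ t ∈ Set.Icc 0 (dist x y), dist (c s) (c t) = |s - t|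

/-- A (Gromov-)hyperbolic space: a geodesic metric space satisfying Gromov's inequality
`(x | z)_o ≥ min ((x | y)_o, (y | z)_o) - δ` for some `δ`. It need not be proper. -/
class HyperbolicSpace (X : Type v) [MetricSpace X] : Prop where
  geodesic : IsGeodesicSpace X
  hyperbolic : ∃ δ : ℝ, 0 ≤ δ ∧ ∀ o x y z : X,
    min (gromovProduct o x y) (gromovProduct o y z) - δ ≤ gromovProduct o x z

/-- `(x_i | y_j)_o → ∞` as `i, j → ∞`. Since changing the base point `o` changes Gromov products
by a bounded amount, asking for all base points is the same as asking for one. -/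
def AsymptoticSeq {X : Type v} [MetricSpace X] (x y : ℕ → X) : Prop :=
  ∀ o : X, Tendsto (fun p : ℕ × ℕ => gromovProduct o (x p.1) (y p.2)) atTop atTop

/-- Sequences convergent at infinity: `(x_i | x_j)_o → ∞` as `i, j → ∞`. -/
def ConvergesAtInfinity {X : Type v} [MetricSpace X] (x : ℕ → X) : Prop :=
  AsymptoticSeq x x

theorem gromovProduct_comm {X : Type v} [MetricSpace X] (o x y : X) :
    gromovProduct o x y = gromovProduct o y x := by
  unfold gromovProduct
  rw [dist_comm x y]
  ring

theorem AsymptoticSeq.symm {X : Type v} [MetricSpace X] {x y : ℕ → X}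
    (h : AsymptoticSeq x y) : AsymptoticSeq y x := by
  intro o
  have hs : Tendsto (Prod.swap : ℕ × ℕ → ℕ × ℕ) atTop atTop := by
    rw [← prod_atTop_atTop_eq]
    exact Filter.tendsto_snd.prodMk Filter.tendsto_fst
  refine ((h o).comp hs).congr fun p => ?_
  exact gromovProduct_comm o _ _

theorem AsymptoticSeq.trans {X : Type v} [MetricSpace X] [HyperbolicSpace X] {x y z : ℕ → X}
    (hxy : AsymptoticSeq x y) (hyz : AsymptoticSeq y z) : AsymptoticSeq x z := by
  intro o
  obtain ⟨δ, -, hδ⟩ := HyperbolicSpace.hyperbolic (X := X)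
  rw [tendsto_atTop]
  intro C
  obtain ⟨⟨a, b⟩, hab⟩ := eventually_atTop.1 (tendsto_atTop.1 (hxy o) (C + δ))
  obtain ⟨⟨c, d⟩, hcd⟩ := eventually_atTop.1 (tendsto_atTop.1 (hyz o) (C + δ))
  refine eventually_atTop.2 ⟨(a, d), fun p hp => ?_⟩
  have h1 := hab (p.1, max b c) ⟨hp.1, le_max_left b c⟩
  have h2 := hcd (max b c, p.2) ⟨le_max_right b c, hp.2⟩
  have h3 := hδ o (x p.1) (y (max b c)) (z p.2)
  have h4 := le_min h1 h2
  simp only at h4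
  linarith

/-- Equivalence of sequences convergent at infinity. -/
def boundarySetoid (X : Type v) [MetricSpace X] [HyperbolicSpace X] :
    Setoid {x : ℕ → X // ConvergesAtInfinity x} where
  r x y := AsymptoticSeq x.1 y.1
  iseqv := ⟨fun x => x.2, fun h => h.symm, fun h₁ h₂ => h₁.trans h₂⟩

/-- The Gromov boundary `∂X`. -/
def GromovBoundary (X : Type v) [MetricSpace X] [HyperbolicSpace X] : Type v :=
  Quotient (boundarySetoid X)

/-- The point of `∂X` to which a sequence convergent at infinity converges. -/
def boundaryPoint {X : Type v} [MetricSpace X] [HyperbolicSpace X]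
    (x : {x : ℕ → X // ConvergesAtInfinity x}) : GromovBoundary X :=
  Quotient.mk (boundarySetoid X) x

/-! ### Group actions on hyperbolic spaces -/

/-- The set of points of `∂X` in the closure of the orbit `G x`, that is, the set of limits in `∂X`
of sequences of points of `G x`. -/
def limitSet (G : Type u) [Group G] {X : Type v} [MetricSpace X] [HyperbolicSpace X]
    [MulAction G X] (x : X) : Set (GromovBoundary X) :=
  {ξ | ∃ s : {s : ℕ → X // ConvergesAtInfinity s},
    (∀ i, s.1 i ∈ MulAction.orbit G x) ∧ boundaryPoint s = ξ}

/-- The action is elementary: its limit set has at most two points. (For isometric actions, the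
limit set does not depend on the base point.) -/
def IsElementaryAction (G : Type u) [Group G] (X : Type v) [MetricSpace X] [HyperbolicSpace X]
    [MulAction G X] : Prop :=
  ∀ x : X, (limitSet G x).encard ≤ 2

/-- Property (NNE): no isometric action on a hyperbolic space is non-elementary. -/
def PropertyNNE (G : Type u) [Group G] : Prop :=
  ∀ (X : Type v) [MetricSpace X] [HyperbolicSpace X] [MulAction G X] [IsIsometricSMul G X],
    IsElementaryAction G X

/-- Property hereditary (NNE): all finite-index subgroups have (NNE). -/
def HereditaryNNE (G : Type u) [Group G] : Prop :=
  ∀ K : Subgroup G, K.FiniteIndex → PropertyNNE.{u, v} K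

/-! ### Group actions on rooted trees -/

/-- `(T, o)` is a rooted tree with vertex set `V`, on which `G` acts by automorphisms fixing the
root. -/
structure IsRootedTreeAction (G : Type u) [Group G] {V : Type w} [MulAction G V]
    (T : SimpleGraph V) (o : V) : Prop where
  isTree : T.IsTree
  adj_smul_iff : ∀ (g : G) (x y : V), T.Adj (g • x) (g • y) ↔ T.Adj x y
  smul_root : ∀ g : G, g • o = o

/-- The `n`th level: the vertices at distance `n` from the root. -/
def level {V : Type w} (T : SimpleGraph V) (o : V) (n : ℕ) : Set V :=
  {x | T.dist o x = n}

/-- The vertex `x` is below `v`: every path from the root to `x` goes through `v`. -/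
def IsBelow {V : Type w} (T : SimpleGraph V) (o v x : V) : Prop :=
  ∀ p : T.Walk o x, v ∈ p.support

/-- `st_G(n)`: the elements of `G` fixing every vertex of the `n`th level. -/
def levelStabilizer (G : Type u) [Group G] {V : Type w} [MulAction G V]
    (T : SimpleGraph V) (o : V) (n : ℕ) : Subgroup G :=
  fixingSubgroup G (level T o n)

/-- `rig_G(v)`: the elements of `G` fixing every vertex which is not below `v`. -/
def rigidStabilizer (G : Type u) [Group G] {V : Type w} [MulAction G V]
    (T : SimpleGraph V) (o v : V) : Subgroup G :=
  fixingSubgroup G {x | ¬ IsBelow T o v x}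

/-- `rig_G(n)`: the subgroup generated by all `rig_G(v)`, `v` in the `n`th level. -/
def rigidLevelStabilizer (G : Type u) [Group G] {V : Type w} [MulAction G V]
    (T : SimpleGraph V) (o : V) (n : ℕ) : Subgroup G :=
  ⨆ v ∈ level T o n, rigidStabilizer G T o v

/-- `G` acts transitively on the `n`th level. -/
def TransitiveOnLevel (G : Type u) [Group G] {V : Type w} [MulAction G V]
    (T : SimpleGraph V) (o : V) (n : ℕ) : Prop :=
  ∀ x ∈ level T o n, ∀ y ∈ level T o n, ∃ g : G, g • x = y

/-- `G` is a branch group with respect to its action on the rooted tree `(T, o)`: the action is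
faithful and, for every `n ≥ 1`, `G` is transitive on the `n`th level and `rig_G(n)` has finite
index. -/
structure IsBranch (G : Type u) [Group G] {V : Type w} [MulAction G V]
    (T : SimpleGraph V) (o : V) : Prop extends IsRootedTreeAction G T o where
  faithful : FaithfulSMul G V
  transitive : ∀ n : ℕ, 1 ≤ n → TransitiveOnLevel G T o n
  finiteIndex : ∀ n : ℕ, 1 ≤ n → (rigidLevelStabilizer G T o n).FiniteIndex

/-- The congruence subgroup property: every finite-index subgroup contains the stabilizer of some
level. -/
def CongruenceSubgroupProperty (G : Type u) [Group G] {V : Type w} [MulAction G V]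
    (T : SimpleGraph V) (o : V) : Prop :=
  ∀ K : Subgroup G, K.FiniteIndex → ∃ n : ℕ, 1 ≤ n ∧ levelStabilizer G T o n ≤ K

end NNE

/-! Take the rigid stabilizers `A i` of the vertices of one level. They commute pairwise (disjoint
supports and faithfulness), and each is conjugate into another one as soon as every vertex of the
level is moved. `isElementaryAction_of_commuting` shows that such a family generating a finite-index
subgroup R forces every action on a hyperbolic space to be elementary.

Write |g| for d(o, g o). If |r²| - |r| is bounded above on R, then `min_dist_le_gromovProduct`
leaves at most one limit point. Otherwise R contains a translation r, a product of elements of the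
commuting `A i`. Logarithmic growth of |a^(2^j)| passes to commuting products and fails for
translations, so some factor a in `A i` does not have it, and a power g of a is a translation. A
conjugate of a yields a translation h in another `A j`. Elements commuting with a translation keep o
near its axis (`exists_dist_zpow_le`). Applied to h and then to g, this puts the whole orbit near
the axis of g, whose two ends are the only possible limit points.

For a finite-index K containing a level stabilizer, rigid stabilizers of deep levels lie in K.
Either K moves every vertex of such a level, or G is finite. Transitivity of K is not needed. -/

namespace NNE

/-! ### Gromov products and sequences convergent at infinity. -/

section GromovProduct

variable {X : Type v} [MetricSpace X]

theorem gromovProduct_nonneg (o x y : X) : 0 ≤ gromovProduct o x y := by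
  unfold gromovProduct
  linarith [dist_triangle_left x y o]

/-- Together with `gromovProduct_smul_left` this exchanges (a o | b o) for |a| - (a⁻¹ o | a⁻¹b o),
the computation behind most estimates below. -/
theorem gromovProduct_add_gromovProduct (o x y : X) :
    gromovProduct o x y + gromovProduct x o y = dist o x := by
  unfold gromovProduct
  rw [dist_comm x o]
  ring

theorem gromovProduct_sub_dist_le (o x x' y : X) :
    gromovProduct o x y - dist x x' ≤ gromovProduct o x' y := by
  unfold gromovProduct
  linarith [dist_triangle o x' x, dist_triangle x' x y, dist_comm x x']

theorem gromovProduct_sub_dist_le_of_base (o o' x y : X) :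
    gromovProduct o x y - dist o o' ≤ gromovProduct o' x y := by
  unfold gromovProduct
  linarith [dist_triangle o o' x, dist_triangle o o' y]

theorem gromovProduct_le_dist (o x y : X) : gromovProduct o x y ≤ dist o x := by
  linarith [gromovProduct_add_gromovProduct o x y, gromovProduct_nonneg x o y]

theorem AsymptoticSeq.of_base {x y : ℕ → X} (o : X)
    (h : ∀ C : ℝ, ∃ N, ∀ i ≥ N, ∀ j ≥ N, C ≤ gromovProduct o (x i) (y j)) :
    AsymptoticSeq x y := by
  intro o'
  rw [tendsto_atTop]
  intro C
  obtain ⟨N, hN⟩ := h (C + dist o o')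
  refine eventually_atTop.2 ⟨(N, N), fun p hp => ?_⟩
  have := hN p.1 hp.1 p.2 hp.2
  linarith [gromovProduct_sub_dist_le_of_base o o' (x p.1) (y p.2)]

theorem AsymptoticSeq.exists_le {x y : ℕ → X} (h : AsymptoticSeq x y) (o : X) (C : ℝ) :
    ∃ N, ∀ i ≥ N, ∀ j ≥ N, C ≤ gromovProduct o (x i) (y j) := by
  obtain ⟨⟨a, b⟩, hab⟩ := eventually_atTop.1 (tendsto_atTop.1 (h o) C)
  exact ⟨max a b, fun i hi j hj =>
    hab (i, j) ⟨(le_max_left a b).trans hi, (le_max_right a b).trans hj⟩⟩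

theorem ConvergesAtInfinity.exists_le_dist {x : ℕ → X} (h : ConvergesAtInfinity x) (o : X)
    (C : ℝ) : ∃ N, ∀ i ≥ N, C ≤ dist o (x i) := by
  obtain ⟨N, hN⟩ := AsymptoticSeq.exists_le h o C
  exact ⟨N, fun i hi => (hN i hi i hi).trans (gromovProduct_le_dist _ _ _)⟩

/-- Two sequences convergent at infinity are equivalent as soon as their Gromov products are
unbounded along some pairs of indices tending to infinity. -/
theorem ConvergesAtInfinity.asymptoticSeq_of_frequently [HyperbolicSpace X] {x y : ℕ → X}
    (hx : ConvergesAtInfinity x) (hy : ConvergesAtInfinity y) (o : X)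
    (h : ∀ (C : ℝ) (N : ℕ), ∃ i ≥ N, ∃ j ≥ N, C ≤ gromovProduct o (x i) (y j)) :
    AsymptoticSeq x y := by
  obtain ⟨δ, hδ0, hδ⟩ := HyperbolicSpace.hyperbolic (X := X)
  refine AsymptoticSeq.of_base o fun C => ?_
  obtain ⟨N₁, h₁⟩ := AsymptoticSeq.exists_le hx o (C + 2 * δ)
  obtain ⟨N₂, h₂⟩ := AsymptoticSeq.exists_le hy o (C + 2 * δ)
  obtain ⟨i₀, hi₀, j₀, hj₀, h₀⟩ := h (C + 2 * δ) (max N₁ N₂)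
  refine ⟨max N₁ N₂, fun i hi j hj => ?_⟩
  have e₁ := h₁ i ((le_max_left _ _).trans hi) i₀ ((le_max_left _ _).trans hi₀)
  have e₂ := h₂ j₀ ((le_max_right _ _).trans hj₀) j ((le_max_right _ _).trans hj)
  have e₃ := hδ o (x i) (x i₀) (y j₀)
  have e₄ := hδ o (x i) (y j₀) (y j)
  have e₅ := le_min e₁ h₀
  have e₆ : C + δ ≤ min (gromovProduct o (x i) (y j₀)) (gromovProduct o (y j₀) (y j)) :=
    le_min (by linarith) (by linarith)
  linarith

end GromovProduct

/-! ### Displacement estimates for isometric actions. -/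

section Action

variable {G : Type u} [Group G] {X : Type v} [MetricSpace X] [MulAction G X]
  [IsIsometricSMul G X]

theorem gromovProduct_smul (g : G) (o x y : X) :
    gromovProduct (g • o) (g • x) (g • y) = gromovProduct o x y := by
  simp [gromovProduct, dist_smul]

theorem gromovProduct_smul_left (g : G) (o x y : X) :
    gromovProduct (g • o) x y = gromovProduct o (g⁻¹ • x) (g⁻¹ • y) := by
  rw [← gromovProduct_smul g⁻¹ (g • o) x y, inv_smul_smul]

theorem dist_smul_smul_base (g h : G) (o : X) :
    dist (g • o) (h • o) = dist o ((g⁻¹ * h) • o) := by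
  rw [← dist_smul g⁻¹ (g • o) (h • o), inv_smul_smul, mul_smul]

theorem dist_inv_smul_base (g : G) (o : X) : dist o (g⁻¹ • o) = dist o (g • o) := by
  rw [← dist_smul g o (g⁻¹ • o), smul_inv_smul, dist_comm]

theorem dist_mul_smul_le (g h : G) (o : X) :
    dist o ((g * h) • o) ≤ dist o (g • o) + dist o (h • o) := by
  rw [mul_smul, ← dist_smul g o (h • o)]
  exact dist_triangle _ _ _

theorem gromovProduct_inv_smul (g : G) (o : X) :
    gromovProduct o (g⁻¹ • o) (g • o) = dist o (g • o) - dist o (g ^ 2 • o) / 2 := by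
  unfold gromovProduct
  rw [dist_inv_smul_base, dist_smul_smul_base, inv_inv, pow_two]
  ring

/-- If the squares of all elements of a subgroup have displacement bounded in terms of that of the
elements, then Gromov products of points of an orbit are bounded below by half the displacement:
the orbit has at most one limit point. -/
theorem min_dist_le_gromovProduct {δ C : ℝ}
    (hδ : ∀ o x y z : X,
      min (gromovProduct o x y) (gromovProduct o y z) - δ ≤ gromovProduct o x z)
    (hδ0 : 0 ≤ δ) (hC : 0 ≤ C) {R : Subgroup G} {o : X}
    (hR : ∀ g ∈ R, dist o (g ^ 2 • o) ≤ dist o (g • o) + C) {g h : G} (hg : g ∈ R) (hh : h ∈ R) :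
    min (dist o (g • o)) (dist o (h • o)) / 2 - C / 2 - 4 * δ ≤
      gromovProduct o (g • o) (h • o) := by
  set t := gromovProduct o (g • o) (h • o) with ht
  set m := min (dist o (g • o)) (dist o (h • o)) with hm
  have hmg : m ≤ dist o (g • o) := min_le_left _ _
  have hmh : m ≤ dist o (h • o) := min_le_right _ _
  have half : ∀ k ∈ R, dist o (k • o) / 2 - C / 2 ≤ gromovProduct o (k⁻¹ • o) (k • o) := by
    intro k hk
    rw [gromovProduct_inv_smul]
    linarith [hR k hk]
  have key : ∀ a b : G, gromovProduct o (a⁻¹ • o) ((a⁻¹ * b) • o) =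
      dist o (a • o) - gromovProduct o (a • o) (b • o) := by
    intro a b
    rw [mul_smul, ← gromovProduct_smul_left, ← gromovProduct_add_gromovProduct o (a • o) (b • o)]
    ring
  -- In the chain g o, g⁻¹ o, g⁻¹h o, h⁻¹g o, h⁻¹ o, h o all five consecutive products exceed t +
  -- 4δ. Four uses of hyperbolicity then give (g o | h o) > t, which is absurd.
  by_contra! hlt
  have e₁ : t + 4 * δ < gromovProduct o (g • o) (g⁻¹ • o) := by
    rw [gromovProduct_comm]
    linarith [half g hg]
  have e₂ : t + 4 * δ < gromovProduct o (g⁻¹ • o) ((g⁻¹ * h) • o) := by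
    rw [key]
    linarith
  have e₃ : t + 4 * δ < gromovProduct o ((g⁻¹ * h) • o) ((h⁻¹ * g) • o) := by
    have := half _ (R.mul_mem (R.inv_mem hg) hh)
    rw [gromovProduct_comm, mul_inv_rev, inv_inv, ← dist_smul_smul_base] at this
    have e : dist (g • o) (h • o) = dist o (g • o) + dist o (h • o) - 2 * t := by
      rw [ht, gromovProduct]; ring
    linarith
  have e₄ : t + 4 * δ < gromovProduct o ((h⁻¹ * g) • o) (h⁻¹ • o) := by
    rw [gromovProduct_comm, key, gromovProduct_comm]
    linarith
  have e₅ : t + 4 * δ < gromovProduct o (h⁻¹ • o) (h • o) := by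
    linarith [half h hh]
  have f₁ := hδ o (g • o) (g⁻¹ • o) ((g⁻¹ * h) • o)
  have f₂ := hδ o (g • o) ((g⁻¹ * h) • o) ((h⁻¹ * g) • o)
  have f₃ := hδ o (g • o) ((h⁻¹ * g) • o) (h⁻¹ • o)
  have f₄ := hδ o (g • o) (h⁻¹ • o) (h • o)
  have g₁ := lt_min e₁ e₂
  have g₂ := lt_min (show t + 3 * δ < gromovProduct o (g • o) ((g⁻¹ * h) • o) by linarith)
    (show t + 3 * δ < _ by linarith : t + 3 * δ <
      gromovProduct o ((g⁻¹ * h) • o) ((h⁻¹ * g) • o))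
  have g₃ := lt_min (show t + 2 * δ < gromovProduct o (g • o) ((h⁻¹ * g) • o) by linarith)
    (show t + 2 * δ < gromovProduct o ((h⁻¹ * g) • o) (h⁻¹ • o) by linarith)
  have g₄ := lt_min (show t + δ < gromovProduct o (g • o) (h⁻¹ • o) by linarith)
    (show t + δ < gromovProduct o (h⁻¹ • o) (h • o) by linarith)
  linarith

/-- The isometry `h` moves `o` along a quasi-geodesic, with constants fit for the
hyperbolicity constant `δ`. -/
def IsTranslation (δ : ℝ) (o : X) (h : G) : Prop :=
  dist o (h • o) + (4 * δ + 1) < dist o (h ^ 2 • o)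

theorem IsTranslation.inv {δ : ℝ} {o : X} {h : G} (hh : IsTranslation δ o h) :
    IsTranslation δ o h⁻¹ := by
  unfold IsTranslation at *
  rwa [inv_pow, dist_inv_smul_base, dist_inv_smul_base]

/-! ### Powers and centralizers of translations. -/

section Translation

variable {δ : ℝ}
  (hδ : ∀ o x y z : X, min (gromovProduct o x y) (gromovProduct o y z) - δ ≤ gromovProduct o x z)
  (hδ0 : 0 ≤ δ) {o : X} {h : G} (hh : IsTranslation δ o h)

include hδ hδ0 hh

/-- With c = (h⁻¹ o | h o), being a translation means |h| - 2c > 4δ + 1. Inductively (h⁻¹ o |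
h⁻⁽ⁿ⁺¹⁾ o) ≥ |h| - c - δ is large, so hyperbolicity makes h⁻⁽ⁿ⁺¹⁾ o inherit from h⁻¹ o its small
product with h o. -/
theorem IsTranslation.gromovProduct_inv_pow_le (n : ℕ) :
    gromovProduct o ((h ^ n)⁻¹ • o) (h • o) ≤ gromovProduct o (h⁻¹ • o) (h • o) + δ := by
  have hc := gromovProduct_inv_smul h o
  unfold IsTranslation at hh
  induction n with
  | zero =>
    have : gromovProduct o ((h ^ 0)⁻¹ • o) (h • o) = 0 := by simp [gromovProduct]
    linarith [gromovProduct_nonneg o (h⁻¹ • o) (h • o)]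
  | succ n ih =>
    have e₁ := hδ o (h⁻¹ • o) ((h ^ (n + 1))⁻¹ • o) (h • o)
    have e₂ : gromovProduct o (h⁻¹ • o) ((h ^ (n + 1))⁻¹ • o) =
        dist o (h • o) - gromovProduct o ((h ^ n)⁻¹ • o) (h • o) := by
      rw [pow_succ, mul_inv_rev, mul_smul, ← gromovProduct_smul_left,
        gromovProduct_comm o _ (h • o), ← gromovProduct_add_gromovProduct o (h • o)]
      ring
    by_contra! hlt
    have := lt_min (show gromovProduct o (h⁻¹ • o) (h • o) + δ <
      gromovProduct o (h⁻¹ • o) ((h ^ (n + 1))⁻¹ • o) by linarith) hlt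
    linarith

theorem IsTranslation.gromovProduct_inv_pow_pow_le (m n : ℕ) :
    gromovProduct o ((h ^ m)⁻¹ • o) (h ^ n • o) ≤
      gromovProduct o (h⁻¹ • o) (h • o) + 2 * δ := by
  have hc := gromovProduct_inv_smul h o
  cases n with
  | zero =>
    have : gromovProduct o ((h ^ m)⁻¹ • o) (h ^ 0 • o) = 0 := by
      simp [gromovProduct, dist_comm]
    linarith [gromovProduct_nonneg o (h⁻¹ • o) (h • o)]
  | succ n =>
    have e₁ := hh.gromovProduct_inv_pow_le hδ hδ0 m
    have e₂ := hh.inv.gromovProduct_inv_pow_le hδ hδ0 n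
    rw [inv_pow, inv_inv, inv_inv, gromovProduct_comm o (h • o)] at e₂
    have e₃ := hδ o ((h ^ m)⁻¹ • o) (h ^ (n + 1) • o) (h • o)
    have e₄ : gromovProduct o (h ^ (n + 1) • o) (h • o) =
        dist o (h • o) - gromovProduct o (h ^ n • o) (h⁻¹ • o) := by
      rw [← gromovProduct_add_gromovProduct o (h • o) (h ^ (n + 1) • o),
        gromovProduct_smul_left h, pow_succ', mul_smul, inv_smul_smul,
        gromovProduct_comm o (h⁻¹ • o), gromovProduct_comm o (h • o)]
      ring
    unfold IsTranslation at hh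
    by_contra! hlt
    have := lt_min hlt (show gromovProduct o (h⁻¹ • o) (h • o) + 2 * δ <
      gromovProduct o (h ^ (n + 1) • o) (h • o) by linarith)
    linarith

theorem IsTranslation.dist_pow_add_one_le (n : ℕ) :
    dist o (h ^ n • o) + 1 ≤ dist o (h ^ (n + 1) • o) := by
  have e₁ := hh.gromovProduct_inv_pow_le hδ hδ0 n
  have hc := gromovProduct_inv_smul h o
  unfold IsTranslation at hh
  rw [gromovProduct.eq_1 o ((h ^ n)⁻¹ • o), dist_inv_smul_base, dist_smul_smul_base, inv_inv,
    ← pow_succ] at e₁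
  linarith

theorem IsTranslation.dist_pow_add_le (n k : ℕ) :
    dist o (h ^ n • o) + k ≤ dist o (h ^ (n + k) • o) := by
  induction k with
  | zero => simp
  | succ k ih =>
    have := hh.dist_pow_add_one_le hδ hδ0 (n + k)
    push_cast
    rw [← add_assoc n k 1]
    linarith

theorem IsTranslation.le_dist_pow (n : ℕ) : (n : ℝ) ≤ dist o (h ^ n • o) := by
  simpa using hh.dist_pow_add_le hδ hδ0 0 n

theorem IsTranslation.min_dist_le_gromovProduct (m n : ℕ) :
    min (dist o (h ^ m • o)) (dist o (h ^ n • o)) - gromovProduct o (h⁻¹ • o) (h • o) - 2 * δ ≤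
      gromovProduct o (h ^ m • o) (h ^ n • o) := by
  wlog hmn : m ≤ n generalizing m n
  · rw [min_comm, gromovProduct_comm o (h ^ m • o)]
    exact this n m (le_of_not_ge hmn)
  obtain ⟨k, rfl⟩ := Nat.exists_eq_add_of_le hmn
  have e₁ := gromovProduct_add_gromovProduct o (h ^ m • o) (h ^ (m + k) • o)
  rw [gromovProduct_smul_left (h ^ m), pow_add, mul_smul, inv_smul_smul] at e₁
  have e₂ := hh.gromovProduct_inv_pow_pow_le hδ hδ0 m k
  rw [pow_add, mul_smul]
  linarith [min_le_left (dist o (h ^ m • o)) (dist o (h ^ m • h ^ k • o))]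

theorem IsTranslation.convergesAtInfinity : ConvergesAtInfinity fun n : ℕ => h ^ n • o := by
  refine AsymptoticSeq.of_base o fun C => ?_
  obtain ⟨N, hN⟩ := exists_nat_ge (C + gromovProduct o (h⁻¹ • o) (h • o) + 2 * δ)
  refine ⟨N, fun i hi j hj => ?_⟩
  have hi' : (N : ℝ) ≤ dist o (h ^ i • o) :=
    (Nat.cast_le.2 hi).trans (hh.le_dist_pow hδ hδ0 i)
  have hj' : (N : ℝ) ≤ dist o (h ^ j • o) :=
    (Nat.cast_le.2 hj).trans (hh.le_dist_pow hδ hδ0 j)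
  have := hh.min_dist_le_gromovProduct hδ hδ0 i j
  linarith [le_min hi' hj']

/-- The orbit of `o` under the centralizer of a translation `h` stays at bounded distance from its
orbit under the powers of `h`. -/
theorem IsTranslation.exists_dist_zpow_le {a : G} (ha : Commute a h) :
    ∃ m : ℤ, dist (a • o) (h ^ m • o) ≤
      dist o (h • o) + 2 * gromovProduct o (h⁻¹ • o) (h • o) + 10 * δ := by
  set c := gromovProduct o (h⁻¹ • o) (h • o) with hc
  have hc0 : 0 ≤ c := gromovProduct_nonneg _ _ _
  -- The endpoints h^(±n) o must be so far away that moving them by |a| does not affect how they are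
  -- seen from a o.
  obtain ⟨n, hn⟩ := exists_nat_gt (2 * dist o (a • o) + c + 4 * δ)
  set l := dist o (a • o) with hl
  have hl0 : 0 ≤ l := dist_nonneg
  set p := (h ^ n)⁻¹ • o with hp
  set q := h ^ n • o with hq
  have hnl := hh.le_dist_pow hδ hδ0 n
  have hap : a • p = (h ^ n)⁻¹ • a • o := by
    rw [hp, smul_smul, smul_smul, (ha.pow_right n).inv_right.eq]
  have haq : a • q = h ^ n • a • o := by
    rw [hq, smul_smul, smul_smul, (ha.pow_right n).eq]
  have hpp : dist p (a • p) = l := by rw [hap, hp, dist_smul]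
  have hqq : dist q (a • q) = l := by rw [haq, hq, dist_smul]
  have hop : dist (a • o) (a • p) = dist o q := by rw [dist_smul, hp, dist_inv_smul_base]
  have hoq : dist (a • o) (a • q) = dist o q := by rw [dist_smul]
  have hpq : dist p q = dist o (h ^ (n + n) • o) := by
    rw [hp, hq, dist_smul_smul_base, inv_inv, pow_add]
  -- `a • o` is close to the segment from `p` to `q`
  have near : gromovProduct (a • o) p q ≤ c + 4 * δ := by
    have e₀ : gromovProduct (a • o) (a • p) (a • q) ≤ c + 2 * δ := by
      rw [gromovProduct_smul]
      exact hh.gromovProduct_inv_pow_pow_le hδ hδ0 n n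
    have e₁ : c + 4 * δ < gromovProduct (a • o) (a • p) p := by
      unfold gromovProduct
      have := dist_triangle (a • o) p (a • p)
      rw [dist_comm (a • p) p]
      linarith
    have e₂ : c + 4 * δ < gromovProduct (a • o) q (a • q) := by
      unfold gromovProduct
      have := dist_triangle (a • o) q (a • q)
      linarith
    -- Seen from a o, the points a p and p are close in direction, and so are q and a q. A large (p
    -- | q) would make (a p | a q) large, against `e₀`.
    by_contra! hlt
    have f₁ := hδ (a • o) (a • p) p q
    have f₂ := hδ (a • o) (a • p) q (a • q)
    have g₁ := lt_min e₁ hlt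
    have g₂ := lt_min (show c + 3 * δ < gromovProduct (a • o) (a • p) q by linarith)
      (show c + 3 * δ < gromovProduct (a • o) q (a • q) by linarith)
    linarith
  -- the power of `h` at which the distance to `p` passes that of `a • o`
  have hex : ∃ k : ℕ, dist p (a • o) ≤ dist o (h ^ k • o) := by
    obtain ⟨k, hk⟩ := exists_nat_ge (dist p (a • o))
    exact ⟨k, hk.trans (hh.le_dist_pow hδ hδ0 k)⟩
  classical
  set k := Nat.find hex with hk
  have hk₁ : dist p (a • o) ≤ dist o (h ^ k • o) := Nat.find_spec hex
  have hk₂ : dist o (h ^ k • o) ≤ dist p (a • o) + dist o (h • o) := by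
    rcases Nat.eq_zero_or_pos k with h0 | h0
    · rw [h0]
      simp only [pow_zero, one_smul, dist_self]
      positivity
    · have := not_le.1 (Nat.find_min hex (Nat.sub_lt h0 one_pos))
      have e := dist_mul_smul_le (h ^ (k - 1)) h o
      rw [← pow_succ, Nat.sub_add_cancel h0] at e
      linarith
  have hk₃ : k ≤ n + n := by
    refine Nat.find_min' hex ?_
    have e₁ := hh.dist_pow_add_le hδ hδ0 n n
    have e₂ : dist p o = dist o q := by rw [dist_comm, hp, dist_inv_smul_base]
    have e₃ := dist_triangle p o (a • o)
    linarith
  obtain ⟨j, hj⟩ := Nat.exists_eq_add_of_le hk₃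
  set y := (h ^ n)⁻¹ • h ^ k • o with hy
  have hpy : dist p y = dist o (h ^ k • o) := by rw [hp, hy, dist_smul]
  have hyq : gromovProduct y p q ≤ c + 2 * δ := by
    have e := hh.gromovProduct_inv_pow_pow_le hδ hδ0 k j
    have e' : (h ^ n)⁻¹ * h ^ k * h ^ j = h ^ n := by
      rw [mul_assoc, ← pow_add, ← hj, pow_add, inv_mul_cancel_left]
    have e'' : q = ((h ^ n)⁻¹ * h ^ k) • h ^ j • o := by rw [smul_smul, e']
    rw [hy, smul_smul, gromovProduct_smul_left, e'', inv_smul_smul, hp, smul_smul]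
    simpa using e
  refine ⟨k - n, ?_⟩
  have hy' : h ^ ((k : ℤ) - n) • o = y := by
    rw [hy, smul_smul, sub_eq_neg_add, zpow_add, zpow_neg, zpow_natCast, zpow_natCast]
  rw [hy']
  -- Both a o and y nearly lie on a geodesic from p to q, at distances from p differing by at most
  -- |h|, so they are close to each other.
  have e₁ := hδ p (a • o) q y
  have e₂ := gromovProduct_add_gromovProduct p (a • o) q
  have e₃ := gromovProduct_add_gromovProduct p y q
  have e₄ : dist p (a • o) - c - 4 * δ ≤
      min (gromovProduct p (a • o) q) (gromovProduct p q y) :=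
    le_min (by linarith) (by rw [gromovProduct_comm p q]; linarith)
  have e₅ : dist (a • o) y = dist p (a • o) + dist p y - 2 * gromovProduct p (a • o) y := by
    unfold gromovProduct; ring
  linarith

end Translation

/-! ### Logarithmic growth of displacement, a substitute for not being loxodromic. -/

/-- The displacement grows at most linearly in `j` along the powers `g ^ (2 ^ j)`. -/
def HasLogGrowth (o : X) (g : G) : Prop :=
  ∃ K C : ℝ, ∀ j : ℕ, dist o (g ^ 2 ^ j • o) ≤ K + j * C

theorem HasLogGrowth.mul {o : X} {a b : G} (ha : HasLogGrowth o a) (hb : HasLogGrowth o b)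
    (hab : Commute a b) : HasLogGrowth o (a * b) := by
  obtain ⟨K, C, h⟩ := ha
  obtain ⟨K', C', h'⟩ := hb
  refine ⟨K + K', C + C', fun j => ?_⟩
  rw [hab.mul_pow]
  linarith [dist_mul_smul_le (a ^ 2 ^ j) (b ^ 2 ^ j) o, h j, h' j]

omit [IsIsometricSMul G X] in
theorem hasLogGrowth_one (o : X) : HasLogGrowth o (1 : G) :=
  ⟨0, 0, fun j => by simp⟩

theorem HasLogGrowth.of_conj {o : X} {t g : G} (h : HasLogGrowth o (t * g * t⁻¹)) :
    HasLogGrowth o g := by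
  obtain ⟨K, C, h⟩ := h
  refine ⟨K + 2 * dist o (t • o), C, fun j => ?_⟩
  have e : g ^ 2 ^ j = t⁻¹ * ((t * g * t⁻¹) ^ 2 ^ j * t) := by
    rw [conj_pow]; group
  have h₁ := dist_mul_smul_le t⁻¹ ((t * g * t⁻¹) ^ 2 ^ j * t) o
  have h₂ := dist_mul_smul_le ((t * g * t⁻¹) ^ 2 ^ j) t o
  rw [dist_inv_smul_base, ← e] at h₁
  linarith [h j]

omit [IsIsometricSMul G X] in
-- If no power is a translation, each squaring of g^(2^j) adds at most 4δ + 1 to the displacement.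
theorem exists_isTranslation_pow {δ : ℝ} {o : X} {g : G} (hg : ¬ HasLogGrowth o g) :
    ∃ k : ℕ, IsTranslation δ o (g ^ k) := by
  by_contra! h
  refine hg ⟨dist o (g • o), 4 * δ + 1, fun j => ?_⟩
  induction j with
  | zero => simp
  | succ j ih =>
    have := h (2 ^ j)
    rw [IsTranslation, not_lt, ← pow_mul, ← pow_succ] at this
    push_cast
    linarith

theorem IsTranslation.not_hasLogGrowth {δ : ℝ}
    (hδ : ∀ o x y z : X,
      min (gromovProduct o x y) (gromovProduct o y z) - δ ≤ gromovProduct o x z)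
    (hδ0 : 0 ≤ δ) {o : X} {h : G} (hh : IsTranslation δ o h) : ¬ HasLogGrowth o h := by
  rintro ⟨K, C, hKC⟩
  have key : ∀ j : ℕ, (2 : ℝ) ^ j ≤ K + j * C := fun j => by
    have := hh.le_dist_pow hδ hδ0 (2 ^ j)
    push_cast at this
    exact this.trans (hKC j)
  have hlim : Tendsto (fun j : ℕ => (j : ℝ) ^ 1 / 2 ^ j) atTop (nhds 0) :=
    tendsto_pow_const_div_const_pow_of_one_lt 1 one_lt_two
  have hlim0 : Tendsto (fun j : ℕ => (j : ℝ) ^ 0 / 2 ^ j) atTop (nhds 0) :=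
    tendsto_pow_const_div_const_pow_of_one_lt 0 one_lt_two
  have hlim' := (hlim0.const_mul K).add (hlim.const_mul C)
  -- Divide 2^j ≤ K + jC by 2^j and let j tend to infinity.
  have h1 : (1 : ℝ) ≤ K * 0 + C * 0 := by
    refine ge_of_tendsto' hlim' fun j => ?_
    have h2 : (0 : ℝ) < 2 ^ j := by positivity
    rw [← mul_div_assoc, ← mul_div_assoc, ← add_div, le_div_iff₀ h2]
    linarith [key j]
  norm_num at h1

theorem exists_dist_smul_le_of_finiteIndex (R : Subgroup G) [R.FiniteIndex] (o : X) :
    ∃ K : ℝ, ∀ g : G, ∃ r ∈ R, dist (g • o) (r • o) ≤ K := by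
  obtain ⟨K, hK⟩ := (Set.finite_range fun q : G ⧸ R => dist o (q.out • o)).bddAbove
  refine ⟨K, fun g => ?_⟩
  -- The coset of g⁻¹ is used so that the correction multiplies g on the right, where it displaces g
  -- o by a bounded amount.
  refine ⟨g * ((g⁻¹ : G) : G ⧸ R).out, ?_, ?_⟩
  · have := QuotientGroup.eq.1 (QuotientGroup.out_eq' ((g⁻¹ : G) : G ⧸ R)).symm
    rwa [inv_inv] at this
  · rw [mul_smul, dist_smul]
    exact hK ⟨_, rfl⟩

end Action

/-! ### Bounding limit sets; the criterion for elementary actions. -/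

section LimitSet

variable {G : Type u} [Group G] {X : Type v} [MetricSpace X] [HyperbolicSpace X] [MulAction G X]
  [IsIsometricSMul G X]

theorem limitSet_subsingleton_of_dist_sq_le {C : ℝ} (hC : 0 ≤ C) {R : Subgroup G}
    [R.FiniteIndex] {o : X} (hR : ∀ g ∈ R, dist o (g ^ 2 • o) ≤ dist o (g • o) + C) :
    (limitSet G o).Subsingleton := by
  obtain ⟨δ, hδ0, hδ⟩ := HyperbolicSpace.hyperbolic (X := X)
  obtain ⟨K, hK⟩ := exists_dist_smul_le_of_finiteIndex R o
  rintro _ ⟨s, hs, rfl⟩ _ ⟨t, ht, rfl⟩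
  refine Quotient.sound (s := boundarySetoid X) (AsymptoticSeq.of_base o fun B => ?_)
  -- One K is lost in passing from |g| to |r|. The other four, once halved, pay for replacing both
  -- orbit points in the Gromov product.
  obtain ⟨N₁, h₁⟩ := ConvergesAtInfinity.exists_le_dist s.2 o (2 * B + 5 * K + C + 8 * δ)
  obtain ⟨N₂, h₂⟩ := ConvergesAtInfinity.exists_le_dist t.2 o (2 * B + 5 * K + C + 8 * δ)
  refine ⟨max N₁ N₂, fun i hi j hj => ?_⟩
  have e₁ := h₁ i ((le_max_left _ _).trans hi)
  have e₂ := h₂ j ((le_max_right _ _).trans hj)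
  obtain ⟨g, hg⟩ := hs i
  obtain ⟨g', hg'⟩ := ht j
  simp only at hg hg'
  rw [← hg] at e₁ ⊢
  rw [← hg'] at e₂ ⊢
  obtain ⟨r, hr, hrK⟩ := hK g
  obtain ⟨r', hr', hrK'⟩ := hK g'
  have e₃ := min_dist_le_gromovProduct hδ hδ0 hC hR hr hr'
  have e₄ := gromovProduct_sub_dist_le o (r • o) (g • o) (r' • o)
  have e₅ := gromovProduct_sub_dist_le o (r' • o) (g' • o) (g • o)
  rw [gromovProduct_comm o _ (g • o), gromovProduct_comm o _ (g • o)] at e₅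
  rw [dist_comm] at e₄ e₅
  have e₆ := dist_triangle_right o (g • o) (r • o)
  have e₇ := dist_triangle_right o (g' • o) (r' • o)
  have e₈ : 2 * B + 4 * K + C + 8 * δ ≤ min (dist o (r • o)) (dist o (r' • o)) :=
    le_min (by linarith) (by linarith)
  linarith

/-- A convergent sequence in the orbit is infinitely often near nonnegative powers of h or
infinitely often near nonnegative powers of h⁻¹. This suffices to identify its limit with the
corresponding end of the axis. -/
theorem encard_limitSet_le_two_of_isTranslation {δ : ℝ}
    (hδ : ∀ o x y z : X,
      min (gromovProduct o x y) (gromovProduct o y z) - δ ≤ gromovProduct o x z)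
    (hδ0 : 0 ≤ δ) {o : X} {h : G} (hh : IsTranslation δ o h) {K : ℝ}
    (hK : ∀ g : G, ∃ m : ℤ, dist (g • o) (h ^ m • o) ≤ K) :
    (limitSet G o).encard ≤ 2 := by
  refine (Set.encard_le_encard (t := {boundaryPoint ⟨_, hh.convergesAtInfinity hδ hδ0⟩,
    boundaryPoint ⟨_, hh.inv.convergesAtInfinity hδ hδ0⟩}) ?_).trans
    ((Set.encard_insert_le _ _).trans_eq (by rw [Set.encard_singleton, one_add_one_eq_two]))
  rintro _ ⟨s, hs, rfl⟩
  have key : ∀ k : G, (hk : IsTranslation δ o k) →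
      (∃ᶠ i in atTop, ∃ n : ℕ, dist (s.1 i) (k ^ n • o) ≤ K) →
      boundaryPoint s = boundaryPoint ⟨_, hk.convergesAtInfinity hδ hδ0⟩ := by
    intro k hk hfreq
    refine Quotient.sound (s := boundarySetoid X) (ConvergesAtInfinity.asymptoticSeq_of_frequently
      s.2 (hk.convergesAtInfinity hδ hδ0) o fun B N => ?_)
    set c := gromovProduct o (k⁻¹ • o) (k • o)
    obtain ⟨N₁, h₁⟩ := ConvergesAtInfinity.exists_le_dist s.2 o (B + 2 * K + c + 2 * δ)
    obtain ⟨i, hi, n, hn⟩ := frequently_atTop.1 hfreq (max N N₁)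
    obtain ⟨M, hM⟩ := exists_nat_ge (B + K + c + 2 * δ)
    refine ⟨i, (le_max_left _ _).trans hi, max N M, le_max_left _ _, ?_⟩
    have e₁ := h₁ i ((le_max_right _ _).trans hi)
    have e₂ := hk.le_dist_pow hδ hδ0 (max N M)
    have e₃ := hk.min_dist_le_gromovProduct hδ hδ0 n (max N M)
    have e₄ := gromovProduct_sub_dist_le o (k ^ n • o) (s.1 i) (k ^ max N M • o)
    have e₅ : (M : ℝ) ≤ (max N M : ℕ) := Nat.cast_le.2 (le_max_right _ _)
    have e₆ := dist_triangle_right o (s.1 i) (k ^ n • o)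
    have e₇ : B + K + c + 2 * δ ≤ min (dist o (k ^ n • o)) (dist o (k ^ max N M • o)) :=
      le_min (by linarith) (by linarith)
    rw [dist_comm] at e₄
    show B ≤ gromovProduct o (s.1 i) (k ^ max N M • o)
    linarith
  have hor : ∀ i, (∃ n : ℕ, dist (s.1 i) (h ^ n • o) ≤ K) ∨
      ∃ n : ℕ, dist (s.1 i) (h⁻¹ ^ n • o) ≤ K := by
    intro i
    obtain ⟨g, hg⟩ := hs i
    obtain ⟨m, hm⟩ := hK g
    simp only at hg
    rw [hg] at hm
    obtain ⟨n, rfl | rfl⟩ := m.eq_nat_or_neg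
    · exact Or.inl ⟨n, by simpa using hm⟩
    · exact Or.inr ⟨n, by simpa using hm⟩
  rcases frequently_or_distrib.1 (Frequently.of_forall (f := atTop) hor) with h₁ | h₁
  · exact Or.inl (key h hh h₁)
  · exact Or.inr (key h⁻¹ hh.inv h₁)

theorem exists_mul_eq_of_mem_sup {G : Type u} [Group G] {H H' : Subgroup G}
    (hH : H' ≤ Subgroup.centralizer H) {g : G} (hg : g ∈ H ⊔ H') :
    ∃ a ∈ H, ∃ b ∈ H', a * b = g := by
  have h := Subgroup.coe_mul_of_right_le_normalizer_left H H'
    (hH.trans (Subgroup.centralizer_le_normalizer _))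
  have hg' : g ∈ ((H ⊔ H' : Subgroup G) : Set G) := hg
  rw [h] at hg'
  exact hg'

omit [HyperbolicSpace X] in
-- An element of the join involves finitely many of the subgroups, so they can be split off one at a
-- time as commuting factors.
theorem hasLogGrowth_of_mem_iSup {ι : Type*} (A : ι → Subgroup G)
    (hcomm : ∀ i j, i ≠ j → ∀ a ∈ A i, ∀ b ∈ A j, Commute a b) {o : X}
    (hA : ∀ i, ∀ a ∈ A i, HasLogGrowth o a) {r : G} (hr : r ∈ ⨆ i, A i) : HasLogGrowth o r := by
  classical
  rw [iSup_eq_iSup_finset, Subgroup.mem_iSup_of_directed] at hr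
  · obtain ⟨s, hs⟩ := hr
    induction s using Finset.induction_on generalizing r with
    | empty =>
      simp only [Finset.notMem_empty, iSup_false, iSup_bot, Subgroup.mem_bot] at hs
      rw [hs]
      exact hasLogGrowth_one o
    | insert i s his ih =>
      rw [Finset.iSup_insert] at hs
      have hcen : ⨆ j ∈ s, A j ≤ Subgroup.centralizer (A i) := by
        refine iSup₂_le fun j hj b hb => Subgroup.mem_centralizer_iff.2 fun a ha => ?_
        exact hcomm i j (fun h => his (h ▸ hj)) a ha b hb
      obtain ⟨a, ha, b, hb, rfl⟩ := exists_mul_eq_of_mem_sup hcen hs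
      exact (hA i a ha).mul (ih hb) (Subgroup.mem_centralizer_iff.1 (hcen hb) a ha)
  · exact Monotone.directed_le fun s t hst => biSup_mono fun i hi => Finset.mem_of_subset hst hi

/-- A group having a finite-index subgroup generated by commuting subgroups, each of which is
conjugate into another one, has only elementary actions on hyperbolic spaces. -/
theorem isElementaryAction_of_commuting {ι : Type*} (A : ι → Subgroup G)
    (hcomm : ∀ i j, i ≠ j → ∀ a ∈ A i, ∀ b ∈ A j, Commute a b)
    (hconj : ∀ i, ∃ j, i ≠ j ∧ ∃ t : G, ∀ a ∈ A i, t * a * t⁻¹ ∈ A j)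
    (hfin : (⨆ i, A i).FiniteIndex) : IsElementaryAction G X := by
  intro o
  obtain ⟨δ, hδ0, hδ⟩ := HyperbolicSpace.hyperbolic (X := X)
  by_cases hR : ∀ g ∈ ⨆ i, A i, dist o (g ^ 2 • o) ≤ dist o (g • o) + (4 * δ + 1)
  · exact (Set.encard_le_one_iff_subsingleton.2
      (limitSet_subsingleton_of_dist_sq_le (by linarith) hR)).trans one_le_two
  push Not at hR
  obtain ⟨r, hr, hrt⟩ := hR
  obtain ⟨i, a, ha, hag⟩ : ∃ i, ∃ a ∈ A i, ¬ HasLogGrowth o a := by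
    by_contra! hlog
    exact IsTranslation.not_hasLogGrowth hδ hδ0 hrt (hasLogGrowth_of_mem_iSup A hcomm hlog hr)
  obtain ⟨k, hk⟩ := exists_isTranslation_pow (δ := δ) hag
  obtain ⟨j, hij, t, ht⟩ := hconj i
  obtain ⟨l, hl⟩ := exists_isTranslation_pow (δ := δ) fun h => hag (HasLogGrowth.of_conj (t := t) h)
  have hg : a ^ k ∈ A i := (A i).pow_mem ha k
  have hh : (t * a * t⁻¹) ^ l ∈ A j := (A j).pow_mem (ht a ha) l
  generalize a ^ k = g at hk hg
  generalize (t * a * t⁻¹) ^ l = h at hl hh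
  have hle : ⨆ i', A i' ≤ A i ⊔ Subgroup.centralizer (A i) := by
    refine iSup_le fun i' => ?_
    by_cases hi : i = i'
    · exact hi ▸ le_sup_left
    · exact le_sup_of_le_right fun b hb =>
        Subgroup.mem_centralizer_iff.2 fun a ha => hcomm i i' hi a ha b hb
  obtain ⟨K, hK⟩ := exists_dist_smul_le_of_finiteIndex (⨆ i', A i') o
  refine encard_limitSet_le_two_of_isTranslation hδ hδ0 hk
    (K := K + (dist o (h • o) + 2 * gromovProduct o (h⁻¹ • o) (h • o) + 10 * δ) +
      (dist o (g • o) + 2 * gromovProduct o (g⁻¹ • o) (g • o) + 10 * δ)) fun x => ?_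
  obtain ⟨y, hy, hxy⟩ := hK x
  -- Here b commutes with h, so b o is near some h^m o and y o = c b o is near c h^m o. Since c h^m
  -- commutes with g, that point is near some g^n o.
  obtain ⟨b, hb, c, hc, rfl⟩ := exists_mul_eq_of_mem_sup le_rfl (hle hy)
  rw [Subgroup.mem_centralizer_iff] at hc
  obtain ⟨m, hm⟩ := hl.exists_dist_zpow_le hδ hδ0 (hcomm i j hij b hb h hh)
  have hcg : Commute (c * h ^ m) g :=
    Commute.mul_left (hc g hg).symm (hcomm i j hij g hg _ ((A j).zpow_mem hh m)).symm
  obtain ⟨n, hn⟩ := hk.exists_dist_zpow_le hδ hδ0 hcg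
  refine ⟨n, ?_⟩
  rw [hc b hb, mul_smul] at hxy
  rw [← dist_smul c] at hm
  rw [mul_smul] at hn
  exact (dist_triangle4 _ _ _ _).trans (add_le_add_three hxy hm hn)

end LimitSet

end NNE

namespace NNE

/-- The empty family generates the trivial subgroup, which has finite index here. -/
theorem propertyNNE_of_finite (G : Type u) [Group G] [Finite G] : PropertyNNE.{u, v} G := by
  intro X _ _ _ _
  exact isElementaryAction_of_commuting (G := G) (X := X) (fun i : Empty => i.elim)
    (fun i => i.elim) (fun i => i.elim) inferInstance

/-! ### Rigid stabilizers in rooted trees. -/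

section Tree

theorem getVert_dist_of_length_eq_dist {V : Type w} {T : SimpleGraph V} {o x y : V}
    {p : T.Walk o x} (hp : p.length = T.dist o x) (hy : y ∈ p.support) :
    p.getVert (T.dist o y) = y := by
  classical
  rw [← SimpleGraph.length_eq_dist_of_subwalk hp (p.isSubwalk_takeUntil hy),
    p.getVert_length_takeUntil hy]

/-- A shortest walk from the root meets each level at most once. -/
theorem IsBelow.eq_of_dist_eq {V : Type w} {T : SimpleGraph V} (hT : T.Connected) {o v v' x : V}
    (h : IsBelow T o v x) (h' : IsBelow T o v' x) (hd : T.dist o v = T.dist o v') : v = v' := by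
  obtain ⟨p, hp⟩ := hT.exists_walk_length_eq_dist o x
  rw [← getVert_dist_of_length_eq_dist hp (h p), ← getVert_dist_of_length_eq_dist hp (h' p), hd]

theorem isBelow_self {V : Type w} (T : SimpleGraph V) (o v : V) : IsBelow T o v v :=
  fun p => p.end_mem_support

theorem IsBelow.dist_le {V : Type w} {T : SimpleGraph V} (hT : T.Connected) {o v x : V}
    (h : IsBelow T o v x) : T.dist o v ≤ T.dist o x := by
  classical
  obtain ⟨p, hp⟩ := hT.exists_walk_length_eq_dist o x
  rw [← hp]
  exact (SimpleGraph.dist_le _).trans (p.length_takeUntil_le_length (h p))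

variable {G : Type u} [Group G] {V : Type w} [MulAction G V] {T : SimpleGraph V} {o : V}

namespace IsRootedTreeAction

theorem exists_walk (hT : IsRootedTreeAction G T o) (g : G) {x : V} (p : T.Walk o x) :
    ∃ q : T.Walk o (g • x), q.length = p.length ∧ q.support = p.support.map (g • ·) := by
  let f : T →g T := ⟨fun y => g • y, fun {a b} h => (hT.adj_smul_iff g a b).2 h⟩
  refine ⟨(p.map f).copy (hT.smul_root g) rfl, ?_, ?_⟩
  · simp
  · simp [f]

theorem dist_smul (hT : IsRootedTreeAction G T o) (g : G) (x : V) :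
    T.dist o (g • x) = T.dist o x := by
  have key : ∀ (g : G) (x : V), T.dist o (g • x) ≤ T.dist o x := by
    intro g x
    obtain ⟨p, hp⟩ := hT.isTree.connected.exists_walk_length_eq_dist o x
    obtain ⟨q, hq, -⟩ := hT.exists_walk g p
    rw [← hp, ← hq]
    exact SimpleGraph.dist_le q
  refine le_antisymm (key g x) ?_
  simpa using key g⁻¹ (g • x)

theorem isBelow_smul (hT : IsRootedTreeAction G T o) (g : G) {v x : V} (h : IsBelow T o v x) :
    IsBelow T o (g • v) (g • x) := by
  intro p
  obtain ⟨q, -, hq⟩ := hT.exists_walk g⁻¹ p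
  have := h (q.copy rfl (inv_smul_smul g x))
  rw [SimpleGraph.Walk.support_copy, hq, List.mem_map] at this
  obtain ⟨y, hy, hyv⟩ := this
  rwa [← hyv, smul_inv_smul]

theorem conj_mem_rigidStabilizer (hT : IsRootedTreeAction G T o) (g : G) {a : G} {v : V}
    (ha : a ∈ rigidStabilizer G T o v) : g * a * g⁻¹ ∈ rigidStabilizer G T o (g • v) := by
  rw [rigidStabilizer, mem_fixingSubgroup_iff] at *
  intro x hx
  rw [mul_smul, mul_smul, ha (g⁻¹ • x), smul_inv_smul]
  intro h
  exact hx (by simpa using hT.isBelow_smul g h)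

theorem rigidStabilizer_le (hT : IsRootedTreeAction G T o) (v : V) :
    rigidStabilizer G T o v ≤ fixingSubgroup G {x | T.dist o x ≤ T.dist o v} := by
  intro a ha
  rw [rigidStabilizer, mem_fixingSubgroup_iff] at ha
  rw [mem_fixingSubgroup_iff]
  have hne : ∀ x, T.dist o x ≤ T.dist o v → x ≠ v → a • x = x := fun x hx hxv =>
    ha x fun h => hxv ((h.eq_of_dist_eq hT.isTree.connected (isBelow_self T o x)
      (le_antisymm (h.dist_le hT.isTree.connected) hx)).symm)
  intro x hx
  by_cases hxv : x = v
  · subst hxv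
    by_contra h
    -- If a moved v, then a v would be another vertex of the same level, hence fixed by a, and
    -- cancelling a gives a v = v.
    exact h (smul_left_cancel a (hne (a • x) (hT.dist_smul a x).le h))
  · exact hne x hx hxv

theorem rigidLevelStabilizer_le (hT : IsRootedTreeAction G T o) {m n : ℕ} (hmn : n ≤ m) :
    rigidLevelStabilizer G T o m ≤ fixingSubgroup G {x | T.dist o x ≤ n} :=
  iSup₂_le fun v hv => (hT.rigidStabilizer_le v).trans
    (fixingSubgroup_antitone G V fun x (hx : T.dist o x ≤ n) => by
      have hv' : T.dist o v = m := hv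
      exact hx.trans (hmn.trans hv'.ge))

theorem commute_of_mem_rigidStabilizer (hT : IsRootedTreeAction G T o) [FaithfulSMul G V]
    {v v' : V} (hd : T.dist o v = T.dist o v') (hne : v ≠ v') {a b : G}
    (ha : a ∈ rigidStabilizer G T o v) (hb : b ∈ rigidStabilizer G T o v') : Commute a b := by
  rw [rigidStabilizer, mem_fixingSubgroup_iff] at ha hb
  have hdisj : (MulAction.toPerm a : Equiv.Perm V).Disjoint (MulAction.toPerm b) := by
    intro x
    by_contra! h
    refine hne (IsBelow.eq_of_dist_eq hT.isTree.connected (x := x) ?_ ?_ hd)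
    · by_contra hx
      exact h.1 (ha x hx)
    · by_contra hx
      exact h.2 (hb x hx)
  refine eq_of_smul_eq_smul (α := V) fun x => ?_
  have := congrArg (fun σ : Equiv.Perm V => σ x) hdisj.commute.eq
  simpa [mul_smul] using this

/-- Asking only that each vertex be moved, instead of transitivity, makes this applicable to
finite-index subgroups. -/
theorem propertyNNE (hT : IsRootedTreeAction G T o) [FaithfulSMul G V] {n : ℕ}
    (hmove : ∀ v ∈ level T o n, ∃ g : G, g • v ≠ v)
    (hfin : (rigidLevelStabilizer G T o n).FiniteIndex) : PropertyNNE.{u, v} G := by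
  intro X _ _ _ _
  refine isElementaryAction_of_commuting (fun v : level T o n => rigidStabilizer G T o v)
    (fun v v' hne a ha b hb => ?_) (fun v => ?_) ?_
  · refine hT.commute_of_mem_rigidStabilizer ?_ (fun h => hne (Subtype.ext h)) ha hb
    have hv : T.dist o v = n := v.2
    have hv' : T.dist o v' = n := v'.2
    rw [hv, hv']
  · obtain ⟨g, hg⟩ := hmove v v.2
    exact ⟨⟨g • v, (hT.dist_smul g v).trans v.2⟩, fun h => hg (congrArg Subtype.val h).symm, g,
      fun a ha => hT.conj_mem_rigidStabilizer g ha⟩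
  · rwa [rigidLevelStabilizer, iSup_subtype'] at hfin

theorem subgroup (hT : IsRootedTreeAction G T o) (K : Subgroup G) :
    IsRootedTreeAction K T o :=
  ⟨hT.isTree, fun g => hT.adj_smul_iff g, fun g => hT.smul_root g⟩

theorem conj_mem_fixingSubgroup_ball (hT : IsRootedTreeAction G T o) {n : ℕ} {a : G}
    (ha : a ∈ fixingSubgroup G {x | T.dist o x ≤ n}) (g : G) :
    g⁻¹ * a * g ∈ fixingSubgroup G {x | T.dist o x ≤ n} := by
  rw [mem_fixingSubgroup_iff] at *
  intro x (hx : T.dist o x ≤ n)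
  rw [mul_smul, mul_smul, ha (g • x) ((hT.dist_smul g x).trans_le hx), inv_smul_smul]

end IsRootedTreeAction

/-- Each rigid stabilizer in G of a vertex of the level already lies in K, so it is also the one
formed in K. -/
theorem rigidLevelStabilizer_subgroup_finiteIndex {K : Subgroup G} {n : ℕ}
    (hfin : (rigidLevelStabilizer G T o n).FiniteIndex)
    (hK : rigidLevelStabilizer G T o n ≤ K) : (rigidLevelStabilizer K T o n).FiniteIndex := by
  have hle : rigidLevelStabilizer G T o n ≤ (rigidLevelStabilizer K T o n).map K.subtype := by
    refine iSup₂_le fun v hv a ha => ?_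
    refine ⟨⟨a, hK (le_biSup (rigidStabilizer G T o) hv ha)⟩, ?_, rfl⟩
    exact le_biSup (rigidStabilizer K T o) hv <| (mem_fixingSubgroup_iff K).2 fun x hx => (mem_fixingSubgroup_iff G).1 ha x hx
  have hle' := Subgroup.comap_mono (f := K.subtype) hle
  rw [Subgroup.comap_map_eq_self_of_injective K.subtype_injective] at hle'
  have : ((rigidLevelStabilizer G T o n).comap K.subtype).FiniteIndex :=
    Subgroup.instFiniteIndex_subgroupOf _ _
  exact Subgroup.finiteIndex_of_le hle'

theorem IsRootedTreeAction.propertyNNE_of_nontrivial (hT : IsRootedTreeAction G T o)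
    [FaithfulSMul G V] {n : ℕ} (hnt : (level T o n).Nontrivial)
    (htrans : TransitiveOnLevel G T o n)
    (hfin : (rigidLevelStabilizer G T o n).FiniteIndex) : PropertyNNE.{u, v} G := by
  refine hT.propertyNNE (fun v hv => ?_) hfin
  obtain ⟨v', hv', hne⟩ := hnt.exists_ne v
  obtain ⟨g, hg⟩ := htrans v hv v' hv'
  exact ⟨g, hg ▸ hne⟩

theorem IsBranch.propertyNNE (hG : IsBranch G T o) : PropertyNNE.{u, v} G := by
  have hT := hG.toIsRootedTreeAction
  have := hG.faithful
  by_cases h : ∃ n, 1 ≤ n ∧ (level T o n).Nontrivial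
  · obtain ⟨n, hn, hnt⟩ := h
    exact hT.propertyNNE_of_nontrivial hnt (hG.transitive n hn) (hG.finiteIndex n hn)
  · push Not at h
    have hone : ∀ g : G, g = 1 := by
      refine fun g => eq_of_smul_eq_smul (α := V) fun x => ?_
      rw [one_smul]
      rcases Nat.eq_zero_or_pos (T.dist o x) with h0 | h0
      · rw [← hT.isTree.connected.dist_eq_zero_iff.1 h0, hT.smul_root]
      · exact h _ h0 (hT.dist_smul g x) rfl
    have : Subsingleton G := ⟨fun a b => (hone a).trans (hone b).symm⟩
    exact propertyNNE_of_finite G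

theorem IsBranch.hereditaryNNE (hG : IsBranch G T o) (hcsp : CongruenceSubgroupProperty G T o) :
    HereditaryNNE.{u, v} G := by
  intro K hK
  have hT := hG.toIsRootedTreeAction
  have := hG.faithful
  obtain ⟨n, hn, hnK⟩ := hcsp K hK
  -- The whole ball is used, not just its sphere: N is still normal, contains rig(m) for all m ≥ n,
  -- and visibly fixes all vertices up to level n.
  set N := fixingSubgroup G {x : V | T.dist o x ≤ n} with hN
  have hNK : N ≤ K := (fixingSubgroup_antitone G V fun x (hx : T.dist o x = n) => hx.le).trans hnK
  have hNfin : N.FiniteIndex :=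
    have := hG.finiteIndex n hn
    Subgroup.finiteIndex_of_le (hT.rigidLevelStabilizer_le le_rfl)
  by_cases h : ∃ m, n ≤ m ∧ ∀ v ∈ level T o m, ∃ g ∈ N, g • v ≠ v
  · obtain ⟨m, hm, hmove⟩ := h
    have : FaithfulSMul K V := ⟨fun h => Subtype.ext (eq_of_smul_eq_smul (α := V) h)⟩
    refine (hT.subgroup K).propertyNNE (n := m) (fun v hv => ?_)
      (rigidLevelStabilizer_subgroup_finiteIndex (hG.finiteIndex m (hn.trans hm))
        ((hT.rigidLevelStabilizer_le hm).trans hNK))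
    obtain ⟨g, hg, hgv⟩ := hmove v hv
    exact ⟨⟨g, hNK hg⟩, hgv⟩
  · push Not at h
    -- N fixes a vertex on every level from n on. As N is normal and G is transitive on these
    -- levels, N fixes them entirely.
    have hbot : N = ⊥ := by
      refine (Subgroup.eq_bot_iff_forall _).2 fun g hg => eq_of_smul_eq_smul (α := V) fun x => ?_
      rw [one_smul]
      rcases le_total (T.dist o x) n with hx | hx
      · exact (mem_fixingSubgroup_iff G).1 hg x hx
      · obtain ⟨v, hv, hfix⟩ := h _ hx
        obtain ⟨t, rfl⟩ := hG.transitive _ (hn.trans hx) v hv x rfl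
        have := hfix _ (hT.conj_mem_fixingSubgroup_ball hg t)
        rwa [mul_smul, mul_smul, inv_smul_eq_iff] at this
    rw [hbot] at hNfin
    have : Finite G := Finite.of_equiv _ (QuotientGroup.quotientBot (G := G)).toEquiv
    exact propertyNNE_of_finite K

end Tree

end NNE

theorem mainTheorem11 {G : Type u} [Group G] {V : Type w} [MulAction G V]
    (T : SimpleGraph V) (o : V) :
    (NNE.IsRootedTreeAction G T o → FaithfulSMul G V →
      (∃ n : ℕ, 1 ≤ n ∧ (NNE.level T o n).Nontrivial ∧ NNE.TransitiveOnLevel G T o n ∧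
        (NNE.rigidLevelStabilizer G T o n).FiniteIndex) →
      NNE.PropertyNNE.{u, v} G) ∧
    (NNE.IsBranch G T o → NNE.PropertyNNE.{u, v} G) ∧
    (NNE.IsBranch G T o → NNE.CongruenceSubgroupProperty G T o →
      NNE.HereditaryNNE.{u, v} G) :=
  ⟨fun hT _ ⟨_, _, hnt, htrans, hfin⟩ => hT.propertyNNE_of_nontrivial hnt htrans hfin,
    NNE.IsBranch.propertyNNE, NNE.IsBranch.hereditaryNNE⟩
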